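/- **Definitions.** Write $x^y = y^{-1}xy$ and $[x,y]=x^{-1}y^{-1}xy$. For a group $Q$, let $Q\wedge Q$ be the group generated by the symbols $x\wedge y$ $(x,y\in Q)$ subject to the relations $$xy\wedge z=(x^y\wedge z^y)(y\wedge z),\qquad x\wedge yz=(x\wedge z)(x^z\wedge y^z),\qquad x\wedge x=1,$$ for all $x,y,z\in Q$. Let $M(Q)$ be the kernel of the homomorphism $Q\wedge Q\to[Q,Q]$, $x\wedge y\mapsto[x,y]$, let $M_0(Q)=\langle x\wedge y \mid x,y\in Q,\ [x,y]=1\rangle\le M(Q)$, and let $B_0(Q)=M(Q)/M_0(Q)$ be the Bogomolov multiplier of $Q$. An extension of groups $1\to N\xrightarrow{\chi} G\to Q\to 1$ is *central* if $\chi(N)\le Z(G)$, *stem* if $\chi(N)\le [G,G]$, and *CP* if every pair of commuting elements of $Q$ has a pair of commuting lifts in $G$. The group $G$ is a *CP cover* of $Q$ if there is a stem central CP extension $1\to N\to G\to Q\to 1$ with $|N|=|B_0(Q)|$. Two groups $G$ and $H$ are *isoclinic* if there are isomorphisms $\alpha:G/Z(G)\to H/Z(H)$ and $\beta:[G,G]\to[H,H]$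 such that $\beta([x_1,x_2])=[y_1,y_2]$ whenever $\alpha(x_iZ(G))=y_iZ(H)$ for $i=1,2$. An *isoclinism family* of finite groups is the class of all finite groups isoclinic to a given finite group. For an isoclinism family $\Phi$ of finite groups (the *base family*), the *covering family* $\tilde\Phi$ is the class of all finite groups that are isoclinic to a CP cover of some group in $\Phi$. **Proposition 4.10.** Let $\Phi$ be an isoclinism family of finite groups. Then every group $G\in\tilde\Phi$ is a CP cover of some group $Q\in\Phi$. -/

import Mathlib

universe u v w

namespace CPCovers

open scoped commutatorElement

/-! ### The non-abelian exterior square and the Bogomolov multiplier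

Conventions: `x ^ y = y⁻¹ * x * y` and `[x, y] = x⁻¹ * y⁻¹ * x * y`. The latter is written
`⁅x⁻¹, y⁻¹⁆` below, since in Mathlib `⁅a, b⁆ = a * b * a⁻¹ * b⁻¹`. -/

/-- The relators of the non-abelian exterior square:
`xy ∧ z = (x^y ∧ z^y)(y ∧ z)`, `x ∧ yz = (x ∧ z)(x^z ∧ y^z)` and `x ∧ x = 1`. -/
inductive ExteriorRel (Q : Type u) [Group Q] : FreeGroup (Q × Q) → Prop
  | mul_left (x y z : Q) : ExteriorRel Q
      (FreeGroup.of (x * y, z) *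
        (FreeGroup.of (y⁻¹ * x * y, y⁻¹ * z * y) * FreeGroup.of (y, z))⁻¹)
  | mul_right (x y z : Q) : ExteriorRel Q
      (FreeGroup.of (x, y * z) *
        (FreeGroup.of (x, z) * FreeGroup.of (z⁻¹ * x * z, z⁻¹ * y * z))⁻¹)
  | self (x : Q) : ExteriorRel Q (FreeGroup.of (x, x))

/-- The non-abelian exterior square `Q ∧ Q`. -/
abbrev ExteriorSquare (Q : Type u) [Group Q] : Type u :=
  PresentedGroup {r | ExteriorRel Q r}

/-- The generator `x ∧ y` of `Q ∧ Q`. -/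
def wedge {Q : Type u} [Group Q] (x y : Q) : ExteriorSquare Q :=
  PresentedGroup.of (x, y)

/-- The commutator homomorphism `Q ∧ Q → Q`, `x ∧ y ↦ [x, y]`, whose image is `[Q, Q]`. -/
def commutatorMap (Q : Type u) [Group Q] : ExteriorSquare Q →* Q :=
  PresentedGroup.toGroup (f := fun p : Q × Q => ⁅p.1⁻¹, p.2⁻¹⁆) (by
    rintro r (⟨x, y, z⟩ | ⟨x, y, z⟩ | ⟨x⟩)
    · simp only [map_mul, map_inv, FreeGroup.lift_apply_of, commutatorElement_def]
      group
    · simp only [map_mul, map_inv, FreeGroup.lift_apply_of, commutatorElement_def]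
      group
    · simp [commutatorElement_def])

/-- `M(Q)`, the kernel of the commutator homomorphism on `Q ∧ Q`. -/
def schurM (Q : Type u) [Group Q] : Subgroup (ExteriorSquare Q) :=
  (commutatorMap Q).ker

/-- `M₀(Q) = ⟨x ∧ y ∣ [x, y] = 1⟩`. -/
def schurM₀ (Q : Type u) [Group Q] : Subgroup (ExteriorSquare Q) :=
  Subgroup.closure {t | ∃ x y : Q, Commute x y ∧ t = wedge x y}

section Lemmas

variable {Q : Type u} [Group Q]

theorem commutatorMap_wedge (x y : Q) : commutatorMap Q (wedge x y) = ⁅x⁻¹, y⁻¹⁆ :=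
  PresentedGroup.toGroup.of _

theorem wedge_mul_left (x y z : Q) :
    wedge (x * y) z = wedge (y⁻¹ * x * y) (y⁻¹ * z * y) * wedge y z := by
  have h := PresentedGroup.one_of_mem (rels := {r | ExteriorRel Q r})
    (ExteriorRel.mul_left x y z)
  rw [map_mul, map_inv, mul_inv_eq_one, map_mul] at h
  exact h

theorem wedge_mul_right (x y z : Q) :
    wedge x (y * z) = wedge x z * wedge (z⁻¹ * x * z) (z⁻¹ * y * z) := by
  have h := PresentedGroup.one_of_mem (rels := {r | ExteriorRel Q r})
    (ExteriorRel.mul_right x y z)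
  rw [map_mul, map_inv, mul_inv_eq_one, map_mul] at h
  exact h

theorem wedge_self (x : Q) : wedge x x = 1 :=
  PresentedGroup.one_of_mem (rels := {r | ExteriorRel Q r}) (ExteriorRel.self x)

/-- Conjugating by `b ∧ d` is acting by `[b, d]`. -/
theorem wedge_mul_wedge (x y b d : Q) :
    wedge x y * wedge b d =
      wedge b d * wedge (⁅b⁻¹, d⁻¹⁆⁻¹ * x * ⁅b⁻¹, d⁻¹⁆) (⁅b⁻¹, d⁻¹⁆⁻¹ * y * ⁅b⁻¹, d⁻¹⁆) := by
  -- expand `ab ∧ cd` in two ways, where `x = a ^ (db)` and `y = c ^ (db)`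
  obtain ⟨a, rfl⟩ : ∃ a, x = (d * b)⁻¹ * a * (d * b) := ⟨(d * b) * x * (d * b)⁻¹, by group⟩
  obtain ⟨c, rfl⟩ : ∃ c, y = (d * b)⁻¹ * c * (d * b) := ⟨(d * b) * y * (d * b)⁻¹, by group⟩
  have h1 := wedge_mul_left a b (c * d)
  have h2 := wedge_mul_right (a * b) c d
  rw [h1] at h2
  rw [show b⁻¹ * (c * d) * b = (b⁻¹ * c * b) * (b⁻¹ * d * b) by group, wedge_mul_right,
    wedge_mul_right b c d,
    wedge_mul_left a b d, show d⁻¹ * (a * b) * d = (d⁻¹ * a * d) * (d⁻¹ * b * d) by group,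
    wedge_mul_left (d⁻¹ * a * d)] at h2
  simp only [mul_assoc, mul_inv_rev, inv_inv, mul_inv_cancel_left] at h2
  have h3 := mul_left_cancel h2
  refine mul_right_cancel (b := wedge (d⁻¹ * (b * d)) (d⁻¹ * (c * d))) ?_
  simp only [commutatorElement_def, mul_assoc, mul_inv_rev, inv_inv, mul_inv_cancel_left]
  exact h3

theorem conj_wedge (t : ExteriorSquare Q) : ∀ x y : Q,
    t⁻¹ * wedge x y * t = wedge ((commutatorMap Q t)⁻¹ * x * commutatorMap Q t)
      ((commutatorMap Q t)⁻¹ * y * commutatorMap Q t) := by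
  have ht : t ∈ Subgroup.closure (Set.range
      (PresentedGroup.of (rels := {r | ExteriorRel Q r}))) := by
    rw [PresentedGroup.closure_range_of]; trivial
  induction ht using Subgroup.closure_induction with
  | mem t ht =>
    obtain ⟨⟨b, d⟩, rfl⟩ := ht
    intro x y
    change (wedge b d)⁻¹ * wedge x y * wedge b d = _
    rw [mul_assoc, wedge_mul_wedge, inv_mul_cancel_left]
    change _ = wedge ((commutatorMap Q (wedge b d))⁻¹ * x * commutatorMap Q (wedge b d))
      ((commutatorMap Q (wedge b d))⁻¹ * y * commutatorMap Q (wedge b d))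
    rw [commutatorMap_wedge]
  | one => intro x y; simp
  | mul s t _ _ hs ht =>
    intro x y
    rw [show (s * t)⁻¹ * wedge x y * (s * t) = t⁻¹ * (s⁻¹ * wedge x y * s) * t by group, hs, ht]
    simp only [map_mul, mul_inv_rev, mul_assoc]
  | inv t _ ht =>
    intro x y
    have h := ht (commutatorMap Q t * x * (commutatorMap Q t)⁻¹)
      (commutatorMap Q t * y * (commutatorMap Q t)⁻¹)
    simp only [mul_assoc, inv_mul_cancel_left, inv_mul_cancel, mul_one] at h
    simp only [map_inv, inv_inv, mul_assoc, ← h, mul_inv_cancel_left, mul_inv_cancel, mul_one]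

theorem schurM_le_center : schurM Q ≤ Subgroup.center (ExteriorSquare Q) := by
  intro t ht
  have h1 : commutatorMap Q t = 1 := ht
  rw [Subgroup.mem_center_iff]
  intro s
  have hs : s ∈ Subgroup.closure (Set.range
      (PresentedGroup.of (rels := {r | ExteriorRel Q r}))) := by
    rw [PresentedGroup.closure_range_of]; trivial
  induction hs using Subgroup.closure_induction with
  | mem s hs =>
    obtain ⟨⟨x, y⟩, rfl⟩ := hs
    have h := conj_wedge t x y
    simp only [h1, inv_one, one_mul, mul_one] at h
    rw [mul_assoc, inv_mul_eq_iff_eq_mul] at h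
    exact h
  | one => simp
  | mul a b _ _ ha hb => exact (Commute.mul_left (a := a) (b := b) (c := t) ha hb)
  | inv a _ ha => exact (Commute.inv_left (a := a) (b := t) ha)

theorem schurM₀_le_schurM : schurM₀ Q ≤ schurM Q := by
  rw [schurM₀, Subgroup.closure_le]
  rintro _ ⟨x, y, h, rfl⟩
  change commutatorMap Q (wedge x y) = 1
  rw [commutatorMap_wedge, commutatorElement_eq_one_iff_commute]
  exact h.inv_inv

instance schurM₀_normal : ((schurM₀ Q).subgroupOf (schurM Q)).Normal where
  conj_mem n hn g := by
    have h : g * n = n * g :=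
      Subtype.ext (Subgroup.mem_center_iff.mp (schurM_le_center n.2) (g : ExteriorSquare Q))
    rwa [h, mul_inv_cancel_right]

end Lemmas

/-- The Bogomolov multiplier `B₀(Q) = M(Q) / M₀(Q)`. -/
abbrev BogomolovMultiplier (Q : Type u) [Group Q] : Type u :=
  schurM Q ⧸ (schurM₀ Q).subgroupOf (schurM Q)

/-! ### Group extensions and CP covers -/

section Extensions

variable {N : Type u} {G : Type v} {Q : Type w} [Group N] [Group G] [Group Q]

/-- The extension `1 → N → G → Q → 1` is central. -/
def IsCentral (e : GroupExtension N G Q) : Prop :=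
  e.inl.range ≤ Subgroup.center G

/-- The extension `1 → N → G → Q → 1` is stem. -/
def IsStem (e : GroupExtension N G Q) : Prop :=
  e.inl.range ≤ commutator G

/-- The extension `1 → N → G → Q → 1` is CP: commuting pairs of elements of `Q` have commuting
lifts in `G`. -/
def IsCP (e : GroupExtension N G Q) : Prop :=
  ∀ x y : Q, Commute x y → ∃ g h : G, e.rightHom g = x ∧ e.rightHom h = y ∧ Commute g h

end Extensions

/-- `G` is a CP cover of `Q`: it is the middle term of a stem central CP extension of some group
`N` by `Q` with `|N| = |B₀(Q)|`. -/
def IsCPCover (G : Type v) (Q : Type w) [Group G] [Group Q] : Prop :=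
  ∃ (N : Type v) (_ : Group N) (e : GroupExtension N G Q),
    IsCentral e ∧ IsStem e ∧ IsCP e ∧ Nonempty (N ≃ BogomolovMultiplier Q)

/-! ### Isoclinism -/

/-- The groups `G` and `H` are isoclinic: there are isomorphisms `α : G/Z(G) → H/Z(H)` and
`β : [G, G] → [H, H]` such that `β [x₁, x₂] = [y₁, y₂]` whenever `α (xᵢ Z(G)) = yᵢ Z(H)`. -/
def IsIsoclinic (G : Type v) (H : Type w) [Group G] [Group H] : Prop :=
  ∃ (α : G ⧸ Subgroup.center G ≃* H ⧸ Subgroup.center H) (β : commutator G ≃* commutator H),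
    ∀ (x₁ x₂ : G) (y₁ y₂ : H), α (x₁ : G ⧸ Subgroup.center G) = (y₁ : H ⧸ Subgroup.center H) →
      α (x₂ : G ⧸ Subgroup.center G) = (y₂ : H ⧸ Subgroup.center H) →
      (β ⟨⁅x₁, x₂⁆, Subgroup.commutator_mem_commutator (Subgroup.mem_top x₁)
        (Subgroup.mem_top x₂)⟩ : H) = ⁅y₁, y₂⁆

/-- `Φ` is an isoclinism family of finite groups: it consists of all the finite groups isoclinic
to some fixed finite group. -/
def IsIsoclinismFamily (Φ : Set GrpCat.{u}) : Prop :=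
  ∃ Q₀ : GrpCat.{u}, Finite Q₀ ∧ ∀ Q : GrpCat.{u}, Q ∈ Φ ↔ Finite Q ∧ IsIsoclinic Q Q₀

/-- The covering family of `Φ`: the finite groups isoclinic to a CP cover of a group in `Φ`. -/
def coveringFamily (Φ : Set GrpCat.{u}) : Set GrpCat.{u} :=
  {G | Finite G ∧ ∃ Q ∈ Φ, ∃ G₁ : GrpCat.{u}, IsCPCover G₁ Q ∧ IsIsoclinic G G₁}

end CPCovers

/-! Let `G` be isoclinic, via `α` and `β`, to a CP cover `G₁` of a member of the family, with kernel
`N₁`. As `N₁` lies in the derived subgroup, it pulls back along `β` to a subgroup `N` of `G`,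
central because `α` and `β` agree modulo centres (`isoclinism_apply_coe`).

A central extension is CP exactly when its kernel contains no nontrivial commutator. This condition
passes from `N₁` to `N`, since `β` matches commutators with commutators. It also makes centres of
the quotients pull back to centres, so the isoclinism descends to `G ⧸ N` (`isIsoclinic_of_ker`),
which therefore stays in the family.

The order of `N` is right because `B₀` is an isoclinism invariant: it is the kernel of the map from
`(G ∧ G) / M₀(G)` to the derived subgroup, and a generator of that quotient depends only on its
entries modulo the centre. -/

namespace CPCovers

open scoped commutatorElement

/-! ### The curly exterior square -/

section CurlySquare

variable {G : Type v} [Group G] {H : Type w} [Group H]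

instance schurM₀_normal_top : (schurM₀ G).Normal where
  conj_mem n hn g := by
    have h : g * n = n * g :=
      Subgroup.mem_center_iff.mp (schurM_le_center (schurM₀_le_schurM hn)) g
    rwa [h, mul_inv_cancel_right]

/-- The quotient `(G ∧ G) / M₀(G)`, the curly exterior square of `G`. -/
abbrev CurlySquare (G : Type v) [Group G] : Type v := ExteriorSquare G ⧸ schurM₀ G

/-- The generator `x ⋏ y` of the curly exterior square. -/
def curlyWedge (x y : G) : CurlySquare G := QuotientGroup.mk (wedge x y)

theorem curlyWedge_mul_left (x y z : G) :
    curlyWedge (x * y) z = curlyWedge (y⁻¹ * x * y) (y⁻¹ * z * y) * curlyWedge y z :=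
  congrArg (QuotientGroup.mk (s := schurM₀ G)) (wedge_mul_left x y z)

theorem curlyWedge_mul_right (x y z : G) :
    curlyWedge x (y * z) = curlyWedge x z * curlyWedge (z⁻¹ * x * z) (z⁻¹ * y * z) :=
  congrArg (QuotientGroup.mk (s := schurM₀ G)) (wedge_mul_right x y z)

theorem curlyWedge_eq_one {x y : G} (h : Commute x y) : curlyWedge x y = 1 :=
  (QuotientGroup.eq_one_iff _).mpr (Subgroup.subset_closure ⟨x, y, h, rfl⟩)

/-- Conjugation by a central factor is trivial, and the term that the factor splits off is a wedge
of commuting elements, killed by `M₀`. -/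
theorem curlyWedge_congr {x x' y y' : G}
    (hx : (x : G ⧸ Subgroup.center G) = x') (hy : (y : G ⧸ Subgroup.center G) = y') :
    curlyWedge x y = curlyWedge x' y' := by
  obtain ⟨z, hz, rfl⟩ : ∃ z ∈ Subgroup.center G, x' = x * z :=
    ⟨x⁻¹ * x', QuotientGroup.eq.mp hx, by group⟩
  obtain ⟨t, ht, rfl⟩ : ∃ z ∈ Subgroup.center G, y' = y * z :=
    ⟨y⁻¹ * y', QuotientGroup.eq.mp hy, by group⟩
  have hconj : ∀ {c : G}, c ∈ Subgroup.center G → ∀ g : G, c⁻¹ * g * c = g := fun hc g => by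
    rw [mul_assoc, Subgroup.mem_center_iff.mp hc g, inv_mul_cancel_left]
  rw [curlyWedge_mul_left, hconj hz, hconj hz, curlyWedge_mul_right, hconj ht, hconj ht,
    curlyWedge_eq_one (x := z) (Subgroup.mem_center_iff.mp hz _).symm,
    curlyWedge_eq_one (y := t) (Subgroup.mem_center_iff.mp ht _), mul_one, one_mul]

theorem curlySquare_hom_ext {K : Type*} [Group K] {f g : CurlySquare G →* K}
    (h : ∀ x y, f (curlyWedge x y) = g (curlyWedge x y)) : f = g :=
  QuotientGroup.monoidHom_ext _ (PresentedGroup.ext fun p => h p.1 p.2)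

/-- A homomorphism of central quotients that respects commuting pairs induces a homomorphism of
curly exterior squares. -/
theorem exists_curlySquare_hom (α : G ⧸ Subgroup.center G →* H ⧸ Subgroup.center H)
    (hα : ∀ (x₁ x₂ : G) (y₁ y₂ : H), α x₁ = y₁ → α x₂ = y₂ → Commute x₁ x₂ → Commute y₁ y₂) :
    ∃ φ : CurlySquare G →* CurlySquare H, ∀ (x₁ x₂ : G) (y₁ y₂ : H), α x₁ = y₁ → α x₂ = y₂ →
      φ (curlyWedge x₁ x₂) = curlyWedge y₁ y₂ := by
  -- The section `s` is multiplicative only modulo the centre, which is all that `curlyWedge_congr`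
  -- requires.
  let s : G → H := fun x => (α x).out
  have hs : ∀ x : G, ((s x : H) : H ⧸ Subgroup.center H) = α x := fun x => QuotientGroup.out_eq' _
  have hrel : ∀ r ∈ {r | ExteriorRel G r},
      FreeGroup.lift (fun p : G × G => curlyWedge (s p.1) (s p.2)) r = 1 := by
    rintro r (⟨x, y, z⟩ | ⟨x, y, z⟩ | ⟨x⟩)
    · simp only [map_mul, map_inv, FreeGroup.lift_apply_of]
      rw [mul_inv_eq_one, curlyWedge_congr (x' := s x * s y) (y' := s z) (by simp [hs]) rfl,
        curlyWedge_mul_left]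
      congr 1
      exact curlyWedge_congr (by simp [hs]) (by simp [hs])
    · simp only [map_mul, map_inv, FreeGroup.lift_apply_of]
      rw [mul_inv_eq_one, curlyWedge_congr (x' := s x) (y' := s y * s z) rfl (by simp [hs]),
        curlyWedge_mul_right]
      congr 1
      exact curlyWedge_congr (by simp [hs]) (by simp [hs])
    · simpa using curlyWedge_eq_one (Commute.refl (s x))
  have hwedge : ∀ x y : G, PresentedGroup.toGroup hrel (wedge x y) = curlyWedge (s x) (s y) :=
    fun x y => PresentedGroup.toGroup.of hrel
  refine ⟨QuotientGroup.lift _ (PresentedGroup.toGroup hrel) ?_, ?_⟩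
  · change schurM₀ G ≤ (PresentedGroup.toGroup hrel).ker
    rw [schurM₀, Subgroup.closure_le]
    rintro _ ⟨x, y, h, rfl⟩
    change PresentedGroup.toGroup hrel (wedge x y) = 1
    rw [hwedge]
    exact curlyWedge_eq_one (hα x y _ _ (hs x).symm (hs y).symm h)
  · intro x₁ x₂ y₁ y₂ h₁ h₂
    change PresentedGroup.toGroup hrel (wedge x₁ x₂) = _
    rw [hwedge]
    exact curlyWedge_congr ((hs x₁).trans h₁) ((hs x₂).trans h₂)

theorem commutatorMap_mem_commutator (t : ExteriorSquare G) :
    commutatorMap G t ∈ commutator G := by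
  have h : (⊤ : Subgroup (ExteriorSquare G)) ≤ (commutator G).comap (commutatorMap G) := by
    rw [← PresentedGroup.closure_range_of, Subgroup.closure_le]
    rintro _ ⟨⟨x, y⟩, rfl⟩
    change commutatorMap G (wedge x y) ∈ commutator G
    rw [commutatorMap_wedge]
    exact Subgroup.commutator_mem_commutator (Subgroup.mem_top _) (Subgroup.mem_top _)
  exact h (Subgroup.mem_top t)

/-- The commutator homomorphism from the curly exterior square onto the derived subgroup. -/
def curlyCommutatorMap (G : Type v) [Group G] : CurlySquare G →* commutator G :=
  QuotientGroup.lift _ ((commutatorMap G).codRestrict _ commutatorMap_mem_commutator)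
    fun _ ht => Subtype.ext (schurM₀_le_schurM ht)

theorem coe_curlyCommutatorMap (x y : G) :
    (curlyCommutatorMap G (curlyWedge x y) : G) = ⁅x⁻¹, y⁻¹⁆ :=
  commutatorMap_wedge x y

/-- In this form, multipliers can be compared through isomorphisms of curly squares. -/
theorem bogomolovMultiplier_equiv_ker (G : Type v) [Group G] :
    Nonempty (BogomolovMultiplier G ≃ (curlyCommutatorMap G).ker) := by
  let f : schurM G →* (curlyCommutatorMap G).ker :=
    ((QuotientGroup.mk' (schurM₀ G)).comp (schurM G).subtype).codRestrict _
      fun t => Subtype.ext t.2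
  have hf : Function.Surjective f := by
    rintro ⟨t, ht⟩
    obtain ⟨t, rfl⟩ := QuotientGroup.mk_surjective t
    exact ⟨⟨t, congrArg Subtype.val ht⟩, rfl⟩
  have hk : (schurM₀ G).subgroupOf (schurM G) = f.ker := by
    ext t
    rw [Subgroup.mem_subgroupOf, MonoidHom.mem_ker, ← QuotientGroup.eq_one_iff]
    exact ⟨fun h => Subtype.ext h, fun h => congrArg Subtype.val h⟩
  exact ⟨((QuotientGroup.quotientMulEquivOfEq hk).trans
    (QuotientGroup.quotientKerEquivOfSurjective f hf)).toEquiv⟩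

end CurlySquare

/-! ### Isoclinism and its invariants -/

section Isoclinism

variable {G : Type v} [Group G] {H : Type w} [Group H]

theorem IsIsoclinic.symm (h : IsIsoclinic G H) : IsIsoclinic H G := by
  obtain ⟨α, β, h⟩ := h
  refine ⟨α.symm, β.symm, fun x₁ x₂ y₁ y₂ h₁ h₂ => ?_⟩
  have h' := h y₁ y₂ x₁ x₂ (by rw [← h₁, α.apply_symm_apply]) (by rw [← h₂, α.apply_symm_apply])
  refine congrArg Subtype.val (a₂ := (⟨⁅y₁, y₂⁆, Subgroup.commutator_mem_commutator
    (Subgroup.mem_top y₁) (Subgroup.mem_top y₂)⟩ : commutator G)) ?_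
  rw [MulEquiv.symm_apply_eq]
  exact Subtype.ext h'.symm

theorem IsIsoclinic.trans {K : Type*} [Group K] (h : IsIsoclinic G H) (h' : IsIsoclinic H K) :
    IsIsoclinic G K := by
  obtain ⟨α, β, h⟩ := h
  obtain ⟨α', β', h'⟩ := h'
  refine ⟨α.trans α', β.trans β', fun x₁ x₂ z₁ z₂ h₁ h₂ => ?_⟩
  obtain ⟨y₁, hy₁⟩ := QuotientGroup.mk_surjective (α x₁)
  obtain ⟨y₂, hy₂⟩ := QuotientGroup.mk_surjective (α x₂)
  rw [← h' y₁ y₂ z₁ z₂ (by rw [hy₁]; exact h₁) (by rw [hy₂]; exact h₂)]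
  exact congrArg (fun t => (β' t : K)) (Subtype.ext (h x₁ x₂ y₁ y₂ hy₁.symm hy₂.symm))

/-- The Bogomolov multiplier is an isoclinism invariant. -/
theorem IsIsoclinic.bogomolovMultiplier_equiv (h : IsIsoclinic G H) :
    Nonempty (BogomolovMultiplier G ≃ BogomolovMultiplier H) := by
  obtain ⟨α, β, h⟩ := h
  -- Injectivity of `β` makes commuting an isoclinism invariant, so the generators of `M₀`
  -- correspond in both directions.
  have hcomm : ∀ (x₁ x₂ : G) (y₁ y₂ : H), α x₁ = y₁ → α x₂ = y₂ →
      (Commute x₁ x₂ ↔ Commute y₁ y₂) := fun x₁ x₂ y₁ y₂ h₁ h₂ => by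
    rw [← commutatorElement_eq_one_iff_commute, ← commutatorElement_eq_one_iff_commute,
      ← h x₁ x₂ y₁ y₂ h₁ h₂, OneMemClass.coe_eq_one, map_eq_one_iff β β.injective]
    exact ⟨fun h => Subtype.ext h, fun h => congrArg Subtype.val h⟩
  have hsymm : ∀ (y : H) (x : G), α.symm y = x → α x = y := fun y x hyx => by
    rw [← hyx, α.apply_symm_apply]
  obtain ⟨φ, hφ⟩ := exists_curlySquare_hom α.toMonoidHom
    fun x₁ x₂ y₁ y₂ h₁ h₂ => (hcomm x₁ x₂ y₁ y₂ h₁ h₂).mp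
  obtain ⟨ψ, hψ⟩ := exists_curlySquare_hom α.symm.toMonoidHom
    fun y₁ y₂ x₁ x₂ h₁ h₂ => (hcomm x₁ x₂ y₁ y₂ (hsymm _ _ h₁) (hsymm _ _ h₂)).mpr
  have hψφ : ψ.comp φ = MonoidHom.id _ := curlySquare_hom_ext fun x₁ x₂ => by
    obtain ⟨y₁, hy₁⟩ := QuotientGroup.mk_surjective (α x₁)
    obtain ⟨y₂, hy₂⟩ := QuotientGroup.mk_surjective (α x₂)
    rw [MonoidHom.comp_apply, hφ x₁ x₂ y₁ y₂ hy₁.symm hy₂.symm]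
    exact hψ y₁ y₂ x₁ x₂ ((α.symm_apply_eq).mpr hy₁) ((α.symm_apply_eq).mpr hy₂)
  have hφψ : φ.comp ψ = MonoidHom.id _ := curlySquare_hom_ext fun y₁ y₂ => by
    obtain ⟨x₁, hx₁⟩ := QuotientGroup.mk_surjective (α.symm y₁)
    obtain ⟨x₂, hx₂⟩ := QuotientGroup.mk_surjective (α.symm y₂)
    rw [MonoidHom.comp_apply, hψ y₁ y₂ x₁ x₂ hx₁.symm hx₂.symm]
    exact hφ x₁ x₂ y₁ y₂ (hsymm _ _ hx₁.symm) (hsymm _ _ hx₂.symm)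
  -- Compatibility with `β` makes `φ` carry one kernel onto the other. The inverses below come from
  -- `[x, y] = ⁅x⁻¹, y⁻¹⁆`.
  have hκ : (curlyCommutatorMap H).comp φ = β.toMonoidHom.comp (curlyCommutatorMap G) :=
    curlySquare_hom_ext fun x₁ x₂ => by
      obtain ⟨y₁, hy₁⟩ := QuotientGroup.mk_surjective (α x₁)
      obtain ⟨y₂, hy₂⟩ := QuotientGroup.mk_surjective (α x₂)
      apply Subtype.ext
      rw [MonoidHom.comp_apply, hφ x₁ x₂ y₁ y₂ hy₁.symm hy₂.symm, coe_curlyCommutatorMap,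
        ← h x₁⁻¹ x₂⁻¹ y₁⁻¹ y₂⁻¹ (by simp [hy₁]) (by simp [hy₂])]
      exact congrArg (fun t => (β t : H)) (Subtype.ext (coe_curlyCommutatorMap x₁ x₂).symm)
  obtain ⟨eG⟩ := bogomolovMultiplier_equiv_ker G
  obtain ⟨eH⟩ := bogomolovMultiplier_equiv_ker H
  refine ⟨eG.trans ((Equiv.subtypeEquiv (MonoidHom.toMulEquiv φ ψ hψφ hφψ).toEquiv
    fun t => ?_).trans eH.symm)⟩
  have ht : curlyCommutatorMap H (φ t) = β (curlyCommutatorMap G t) := DFunLike.congr_fun hκ t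
  change curlyCommutatorMap G t = 1 ↔ curlyCommutatorMap H (φ t) = 1
  rw [ht, map_eq_one_iff β β.injective]

/-- The two isomorphisms of an isoclinism agree on the image of the derived subgroup in the
central quotient. -/
theorem isoclinism_apply_coe {α : G ⧸ Subgroup.center G ≃* H ⧸ Subgroup.center H}
    {β : commutator G ≃* commutator H}
    (h : ∀ (x₁ x₂ : G) (y₁ y₂ : H), α (x₁ : G ⧸ Subgroup.center G) = (y₁ : H ⧸ Subgroup.center H) →
      α (x₂ : G ⧸ Subgroup.center G) = (y₂ : H ⧸ Subgroup.center H) →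
      (β ⟨⁅x₁, x₂⁆, Subgroup.commutator_mem_commutator (Subgroup.mem_top x₁)
        (Subgroup.mem_top x₂)⟩ : H) = ⁅y₁, y₂⁆) (t : commutator G) :
    α ((t : G) : G ⧸ Subgroup.center G) = ((β t : H) : H ⧸ Subgroup.center H) := by
  obtain ⟨t, ht⟩ := t
  have ht' := ht
  rw [commutator_def, Subgroup.commutator_def] at ht'
  -- `β` needs a membership proof at every stage of the induction, so the claim carries one.
  suffices ∃ ht : t ∈ commutator G,
      α (t : G ⧸ Subgroup.center G) = ((β ⟨t, ht⟩ : H) : H ⧸ Subgroup.center H) from this.2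
  clear ht
  induction ht' using Subgroup.closure_induction with
  | mem t ht =>
    obtain ⟨x₁, -, x₂, -, rfl⟩ := ht
    refine ⟨Subgroup.commutator_mem_commutator (Subgroup.mem_top _) (Subgroup.mem_top _), ?_⟩
    obtain ⟨y₁, hy₁⟩ := QuotientGroup.mk_surjective (α x₁)
    obtain ⟨y₂, hy₂⟩ := QuotientGroup.mk_surjective (α x₂)
    rw [h x₁ x₂ y₁ y₂ hy₁.symm hy₂.symm]
    simp only [commutatorElement_def, QuotientGroup.mk_mul, QuotientGroup.mk_inv, map_mul, map_inv,
      hy₁, hy₂]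
  | one =>
    refine ⟨one_mem _, ?_⟩
    rw [show (⟨1, one_mem _⟩ : commutator G) = 1 from rfl, map_one β]
    simp
  | mul a b _ _ ha hb =>
    obtain ⟨ha, ha'⟩ := ha
    obtain ⟨hb, hb'⟩ := hb
    refine ⟨mul_mem ha hb, ?_⟩
    rw [← MulMemClass.mk_mul_mk _ a b ha hb, map_mul β]
    simp [ha', hb']
  | inv a _ ha =>
    obtain ⟨ha, ha'⟩ := ha
    refine ⟨inv_mem ha, ?_⟩
    rw [show (⟨a⁻¹, inv_mem ha⟩ : commutator G) = ⟨a, ha⟩⁻¹ from rfl, map_inv β]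
    simp [ha']

end Isoclinism

/-! ### Isoclinism of quotients by kernels without commutators -/

section CentralQuotients

theorem exists_mulEquiv_of_ker_eq {G A B : Type*} [Group G] [Group A] [Group B] (f : G →* A)
    (g : G →* B) (hf : Function.Surjective f) (hg : Function.Surjective g) (h : f.ker = g.ker) :
    ∃ e : A ≃* B, ∀ x, e (f x) = g x := by
  let ef := QuotientGroup.quotientKerEquivOfSurjective f hf
  refine ⟨ef.symm.trans ((QuotientGroup.quotientMulEquivOfEq h).trans
    (QuotientGroup.quotientKerEquivOfSurjective g hg)), fun x => ?_⟩
  have hx : ef.symm (f x) = (x : G ⧸ f.ker) := (MulEquiv.symm_apply_eq _).mpr rfl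
  rw [MulEquiv.trans_apply, hx]
  rfl

variable {G : Type*} [Group G] {Q : Type*} [Group Q]

/-- A surjective homomorphism whose kernel contains no nontrivial commutator reflects central
elements. -/
theorem map_mem_center_iff {f : G →* Q} (hf : Function.Surjective f)
    (hc : ∀ x y : G, f ⁅x, y⁆ = 1 → ⁅x, y⁆ = 1) (x : G) :
    f x ∈ Subgroup.center Q ↔ x ∈ Subgroup.center G := by
  simp only [Subgroup.mem_center_iff]
  refine ⟨fun h g => ?_, fun h q => ?_⟩
  · rw [← commutatorElement_eq_one_iff_mul_comm]
    apply hc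
    rw [map_commutatorElement, commutatorElement_eq_one_iff_mul_comm]
    exact h (f g)
  · obtain ⟨g, rfl⟩ := hf q
    rw [← map_mul, h, map_mul]

/-- The restriction of a homomorphism to derived subgroups. -/
def commutatorRestrict (f : G →* Q) : commutator G →* commutator Q :=
  (f.comp (commutator G).subtype).codRestrict _ fun t => by
    have h : (commutator G).map f ≤ commutator Q := by
      rw [commutator_def, Subgroup.map_commutator]
      exact Subgroup.commutator_mono le_top le_top
    exact h (Subgroup.mem_map_of_mem f t.2)

theorem commutatorRestrict_surjective {f : G →* Q} (hf : Function.Surjective f) :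
    Function.Surjective (commutatorRestrict f) := by
  rintro ⟨q, hq⟩
  have h : commutator Q = (commutator G).map f := by
    rw [commutator_def, commutator_def, Subgroup.map_commutator,
      Subgroup.map_top_of_surjective f hf]
  rw [h] at hq
  obtain ⟨t, ht, rfl⟩ := hq
  exact ⟨⟨t, ht⟩, rfl⟩

/-- Quotients by corresponding kernels without nontrivial commutators of isoclinic groups are
isoclinic. -/
theorem isIsoclinic_of_ker {G₁ Q₁ : Type*} [Group G₁] [Group Q₁]
    {α : G ⧸ Subgroup.center G ≃* G₁ ⧸ Subgroup.center G₁}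
    {β : commutator G ≃* commutator G₁}
    (h : ∀ (x₁ x₂ : G) (y₁ y₂ : G₁),
      α (x₁ : G ⧸ Subgroup.center G) = (y₁ : G₁ ⧸ Subgroup.center G₁) →
      α (x₂ : G ⧸ Subgroup.center G) = (y₂ : G₁ ⧸ Subgroup.center G₁) →
      (β ⟨⁅x₁, x₂⁆, Subgroup.commutator_mem_commutator (Subgroup.mem_top x₁)
        (Subgroup.mem_top x₂)⟩ : G₁) = ⁅y₁, y₂⁆)
    {f : G →* Q} {f₁ : G₁ →* Q₁} (hf : Function.Surjective f) (hf₁ : Function.Surjective f₁)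
    (hc : ∀ x y : G, f ⁅x, y⁆ = 1 → ⁅x, y⁆ = 1)
    (hc₁ : ∀ x y : G₁, f₁ ⁅x, y⁆ = 1 → ⁅x, y⁆ = 1)
    (hker : ∀ t : commutator G, f t = 1 ↔ f₁ (β t) = 1) :
    IsIsoclinic Q Q₁ := by
  -- Central elements are reflected, so `f` and `f₁` induce isomorphisms of central quotients, and
  -- `α` transfers.
  have hZ : ((QuotientGroup.mk' (Subgroup.center Q)).comp f).ker =
      (QuotientGroup.mk' (Subgroup.center G)).ker := by
    ext x
    simp [MonoidHom.mem_ker, map_mem_center_iff hf hc]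
  have hZ₁ : (QuotientGroup.mk' (Subgroup.center G₁)).ker =
      ((QuotientGroup.mk' (Subgroup.center Q₁)).comp f₁).ker := by
    ext x
    simp [MonoidHom.mem_ker, map_mem_center_iff hf₁ hc₁]
  obtain ⟨γ, hγ⟩ := exists_mulEquiv_of_ker_eq
    ((QuotientGroup.mk' (Subgroup.center Q)).comp f) (QuotientGroup.mk' (Subgroup.center G))
    ((QuotientGroup.mk'_surjective _).comp hf) (QuotientGroup.mk'_surjective _) hZ
  obtain ⟨γ₁, hγ₁⟩ := exists_mulEquiv_of_ker_eq
    (QuotientGroup.mk' (Subgroup.center G₁)) ((QuotientGroup.mk' (Subgroup.center Q₁)).comp f₁)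
    (QuotientGroup.mk'_surjective _) ((QuotientGroup.mk'_surjective _).comp hf₁) hZ₁
  obtain ⟨δ, hδ⟩ := exists_mulEquiv_of_ker_eq (commutatorRestrict f)
    ((commutatorRestrict f₁).comp β.toMonoidHom) (commutatorRestrict_surjective hf)
    ((commutatorRestrict_surjective hf₁).comp β.surjective) (by
      ext t
      rw [MonoidHom.mem_ker, MonoidHom.mem_ker, Subtype.ext_iff, Subtype.ext_iff]
      exact hker t)
  refine ⟨γ.trans (α.trans γ₁), δ, fun x₁ x₂ y₁ y₂ h₁ h₂ => ?_⟩
  -- The lift recovers `y` only modulo the centre; `hcen` shows that commutators do not see the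
  -- difference.
  have lift : ∀ (g : G) (y : Q₁), (γ.trans (α.trans γ₁)) (f g : Q ⧸ Subgroup.center Q) = y →
      ∃ g₁ : G₁, α g = g₁ ∧ (f₁ g₁ : Q₁ ⧸ Subgroup.center Q₁) = y := fun g y hy => by
    obtain ⟨g₁, hg₁⟩ := QuotientGroup.mk_surjective (α g)
    refine ⟨g₁, hg₁.symm, ?_⟩
    rw [← hy]
    refine (hγ₁ g₁).symm.trans (congrArg γ₁ (hg₁.trans (congrArg α ?_)))
    exact (hγ g).symm
  obtain ⟨g, rfl⟩ := hf x₁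
  obtain ⟨k, rfl⟩ := hf x₂
  obtain ⟨g₁, hg, hg₁⟩ := lift g y₁ h₁
  obtain ⟨k₁, hk, hk₁⟩ := lift k y₂ h₂
  have hcen : ∀ {a b c : Q₁}, (a : Q₁ ⧸ Subgroup.center Q₁) = b → ⁅a, c⁆ = ⁅b, c⁆ ∧
      ⁅c, a⁆ = ⁅c, b⁆ := fun {a b c} hab => by
    obtain ⟨z, hz, rfl⟩ : ∃ z ∈ Subgroup.center Q₁, b = a * z :=
      ⟨a⁻¹ * b, QuotientGroup.eq.mp hab, by group⟩
    have hz' : ∀ g, z * g = g * z := fun g => (Subgroup.mem_center_iff.mp hz g).symm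
    simp only [commutatorElement_def, mul_inv_rev, mul_assoc]
    constructor
    · rw [← mul_assoc z c, hz' c, mul_assoc, mul_inv_cancel_left]
    · rw [← mul_assoc z c⁻¹, hz' c⁻¹, mul_assoc, mul_inv_cancel_left]
  rw [← (hcen hg₁).1, ← (hcen hk₁).2, ← map_commutatorElement f₁ g₁ k₁,
    ← h g k g₁ k₁ hg hk]
  have hδ' := congrArg Subtype.val (hδ ⟨⁅g, k⁆, Subgroup.commutator_mem_commutator
    (Subgroup.mem_top g) (Subgroup.mem_top k)⟩)
  refine Eq.trans (congrArg (fun t => (δ t : Q₁)) (Subtype.ext ?_)) hδ'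
  exact (map_commutatorElement f g k).symm

end CentralQuotients

/-! ### Transporting a CP cover along an isoclinism -/

section Extensions

variable {N : Type u} {G : Type v} {Q : Type w} [Group N] [Group G] [Group Q]

/-- In a central CP extension, the kernel contains no nontrivial commutator. -/
theorem commutatorElement_eq_one_of_isCP {e : GroupExtension N G Q} (hcen : IsCentral e)
    (hcp : IsCP e) (x y : G) (h : e.rightHom ⁅x, y⁆ = 1) : ⁅x, y⁆ = 1 := by
  rw [map_commutatorElement, commutatorElement_eq_one_iff_commute] at h
  obtain ⟨g, k, hg, hk, hgk⟩ := hcp _ _ h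
  -- Two lifts of one element differ by a central factor, so if one pair of lifts commutes, every
  -- pair does.
  have key : ∀ {a b : G}, e.rightHom a = e.rightHom b → ∃ z ∈ Subgroup.center G, b = a * z :=
    fun {a b} hab => ⟨a⁻¹ * b, hcen (by
      rw [e.range_inl_eq_ker_rightHom, MonoidHom.mem_ker]
      simp [hab]), by group⟩
  obtain ⟨z, hz, rfl⟩ := key hg
  obtain ⟨t, ht, rfl⟩ := key hk
  rw [commutatorElement_eq_one_iff_commute]
  have hz' : ∀ g, Commute g z := Subgroup.mem_center_iff.mp hz
  have ht' : ∀ g, Commute g t := Subgroup.mem_center_iff.mp ht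
  exact ((hgk.mul_right (ht' g)).mul_left (hz' _).symm)

/-- The extension of a quotient group by the normal subgroup. -/
def quotientExtension (N : Subgroup G) [N.Normal] : GroupExtension N G (G ⧸ N) where
  inl := N.subtype
  rightHom := QuotientGroup.mk' N
  inl_injective := N.subtype_injective
  range_inl_eq_ker_rightHom := by simp
  rightHom_surjective := QuotientGroup.mk'_surjective N

/-- A group isoclinic to a CP cover of `Q` is a CP cover of a quotient that is isoclinic
to `Q`. -/
theorem IsIsoclinic.exists_isCPCover_quotient {G₁ : Type*} [Group G₁] (h : IsIsoclinic G G₁)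
    (hcover : IsCPCover G₁ Q) :
    ∃ (N : Subgroup G) (_ : N.Normal), IsIsoclinic (G ⧸ N) Q ∧ IsCPCover G (G ⧸ N) := by
  obtain ⟨α, β, hαβ⟩ := h
  obtain ⟨N₁, _, e, hcen, hstem, hcp, ⟨eN⟩⟩ := hcover
  let M : Subgroup (commutator G) := (e.rightHom.ker.comap (commutator G₁).subtype).comap
    β.toMonoidHom
  let N : Subgroup G := M.map (commutator G).subtype
  have hmem : ∀ t : commutator G, (t : G) ∈ N ↔ e.rightHom (β t) = 1 := fun t =>
    Subgroup.mem_map_iff_mem (commutator G).subtype_injective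
  have hNcomm : N ≤ commutator G := Subgroup.map_subtype_le _
  have hNcen : N ≤ Subgroup.center G := fun t ht => by
    lift t to commutator G using hNcomm ht
    rw [hmem] at ht
    rw [← QuotientGroup.eq_one_iff, ← map_eq_one_iff α α.injective, isoclinism_apply_coe hαβ,
      QuotientGroup.eq_one_iff]
    exact hcen (e.range_inl_eq_ker_rightHom ▸ ht)
  have hnormal : N.Normal := ⟨fun n hn g => by
    rwa [Subgroup.mem_center_iff.mp (hNcen hn) g, mul_inv_cancel_right]⟩
  have hc₁ := commutatorElement_eq_one_of_isCP hcen hcp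
  -- `β` sends a commutator in `N` to a commutator in the kernel of `e`, which is trivial.
  have hc : ∀ x y : G, QuotientGroup.mk' N ⁅x, y⁆ = 1 → ⁅x, y⁆ = 1 := fun x y hxy => by
    have hxy' := (hmem ⟨⁅x, y⁆, Subgroup.commutator_mem_commutator (Subgroup.mem_top x)
      (Subgroup.mem_top y)⟩).mp ((QuotientGroup.eq_one_iff _).mp hxy)
    obtain ⟨x', hx'⟩ := QuotientGroup.mk_surjective (α x)
    obtain ⟨y', hy'⟩ := QuotientGroup.mk_surjective (α y)
    have hβ := hαβ x y x' y' hx'.symm hy'.symm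
    rw [hβ] at hxy'
    rw [hc₁ _ _ hxy', OneMemClass.coe_eq_one, map_eq_one_iff β β.injective] at hβ
    exact congrArg Subtype.val hβ
  have hiso : IsIsoclinic (G ⧸ N) Q := isIsoclinic_of_ker hαβ (QuotientGroup.mk'_surjective N)
    e.rightHom_surjective hc hc₁ fun t => by
      rw [← hmem]
      exact QuotientGroup.eq_one_iff _
  refine ⟨N, hnormal, hiso, N, inferInstance, quotientExtension N, ?_, ?_, ?_, ?_⟩
  · exact N.range_subtype.le.trans hNcen
  · exact N.range_subtype.le.trans hNcomm
  · intro x y hxy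
    obtain ⟨g, rfl⟩ := QuotientGroup.mk_surjective x
    obtain ⟨k, rfl⟩ := QuotientGroup.mk_surjective y
    refine ⟨g, k, rfl, rfl, ?_⟩
    rw [← commutatorElement_eq_one_iff_commute]
    apply hc
    rw [map_commutatorElement, commutatorElement_eq_one_iff_commute]
    exact hxy
  · obtain ⟨eB⟩ := hiso.bogomolovMultiplier_equiv
    -- Stemness puts the whole kernel in the range of `β`, so no element is lost when it is pulled
    -- back to `N`.
    have hker : ∀ x : G₁, x ∈ e.rightHom.ker → x ∈ commutator G₁ := fun x hx =>
      hstem (e.range_inl_eq_ker_rightHom ▸ hx)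
    let e₁ : N ≃ M := (M.equivMapOfInjective _ (commutator G).subtype_injective).symm.toEquiv
    let e₂ : M ≃ e.rightHom.ker :=
      { toFun := fun t => ⟨β t, t.2⟩
        invFun := fun x => ⟨β.symm ⟨x, hker x x.2⟩, by
          change e.rightHom (β (β.symm _)) = 1
          rw [β.apply_symm_apply]
          exact x.2⟩
        left_inv := fun t => Subtype.ext (β.symm_apply_apply t)
        right_inv := fun x => Subtype.ext
          (congrArg (fun t : commutator G₁ => (t : G₁))
            (β.apply_symm_apply ⟨x, hker x x.2⟩)) }
    let e₃ : e.rightHom.ker ≃ N₁ := ((MonoidHom.ofInjective e.inl_injective).trans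
      (MulEquiv.subgroupCongr e.range_inl_eq_ker_rightHom)).symm.toEquiv
    exact ⟨e₁.trans (e₂.trans (e₃.trans (eN.trans eB.symm)))⟩

end Extensions

end CPCovers

theorem proposition4p10 (Φ : Set GrpCat.{u}) (hΦ : CPCovers.IsIsoclinismFamily Φ)
    (G : GrpCat.{u}) (hG : G ∈ CPCovers.coveringFamily Φ) :
    ∃ Q ∈ Φ, CPCovers.IsCPCover G Q := by
  obtain ⟨Q₀, -, hΦ⟩ := hΦ
  obtain ⟨hfin, Q₁, hQ₁, G₁, hcover, hiso⟩ := hG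
  obtain ⟨N, _, hN, hGN⟩ := hiso.exists_isCPCover_quotient hcover
  exact ⟨GrpCat.of (G ⧸ N), (hΦ _).mpr ⟨Quotient.finite _, hN.trans ((hΦ Q₁).mp hQ₁).2⟩, hGN⟩
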